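/- Let $L/K$ be a cyclic extension of number fields, i.e. a Galois extension with cyclic Galois group. Let $\mathbb{I}_K=\mathbb{A}_K^\times$ and $\mathbb{I}_L=\mathbb{A}_L^\times$ be the idele groups, let $K^*$ be embedded diagonally in $\mathbb{I}_K$, and let $N:\mathbb{I}_L\to\mathbb{I}_K$ be the idele norm, given at every finite or infinite place $w$ of $K$ by $$N(x)_w=\prod_{v\mid w}N_{L_v/K_w}(x_v),$$ the product over the places $v$ of $L$ above $w$. Then the subgroup $K^*N(\mathbb{I}_L)$ has finite index in $\mathbb{I}_K$: $$[\mathbb{I}_K:K^*N(\mathbb{I}_L)]<\infty .$$ -/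

import Mathlib

noncomputable section

namespace NormIndex

open NumberField IsDedekindDomain IsDedekindDomain.HeightOneSpectrum

variable {K L : Type*} [Field K] [NumberField K] [Field L] [NumberField L] [Algebra K L]

/-! ### Finite places: the extension of completions `L_w / K_v` and its norm -/

section FinitePlaces

variable (v : HeightOneSpectrum (𝓞 K)) (w : HeightOneSpectrum (𝓞 L))
  [w.asIdeal.LiesOver v.asIdeal]

/-- For a prime `w` of `L` above the prime `v` of `K`, the ring homomorphism `K_v → L_w` which
extends `K → L` by continuity. -/
def finiteCompletionMap : v.adicCompletion K →+* w.adicCompletion L :=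
  ((adicCompletion.equiv L w).symm.toRingHom.comp
    (UniformSpace.Completion.mapRingHom
      (algebraMap (WithVal (v.valuation K)) (WithVal (w.valuation L)))
      (uniformContinuous_algebraMap_liesOver K L v w).continuous)).comp
    (adicCompletion.equiv K v).toRingHom

theorem continuous_finiteCompletionMap : Continuous (finiteCompletionMap v w) :=
  (adicCompletion.continuous_ofCompletion L w).comp <|
    UniformSpace.Completion.continuous_map.comp (adicCompletion.continuous_toCompletion K v)

theorem finiteCompletionMap_algebraMap (x : K) :
    finiteCompletionMap v w (algebraMap K (v.adicCompletion K) x) =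
      algebraMap L (w.adicCompletion L) (algebraMap K L x) := by
  apply adicCompletion.ext
  exact UniformSpace.Completion.mapRingHom_coe
    (uniformContinuous_algebraMap_liesOver K L v w).continuous (WithVal.toVal (v.valuation K) x)

/-- `L_w` as a `K_v`-algebra. -/
abbrev finiteCompletionAlgebra : Algebra (v.adicCompletion K) (w.adicCompletion L) :=
  (finiteCompletionMap v w).toAlgebra

/-- The local norm `N_{L_w / K_v} : L_w → K_v` at a finite place. -/
def finiteLocalNorm : w.adicCompletion L →* v.adicCompletion K :=
  letI := finiteCompletionAlgebra v w
  Algebra.norm (v.adicCompletion K)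

theorem finite_finiteCompletionAlgebra :
    letI := finiteCompletionAlgebra v w
    Module.Finite (v.adicCompletion K) (w.adicCompletion L) := by
  let _ := finiteCompletionAlgebra v w
  have : ContinuousSMul (v.adicCompletion K) (w.adicCompletion L) :=
    ⟨((continuous_finiteCompletionMap v w).comp continuous_fst).mul continuous_snd⟩
  have : IsScalarTower K (v.adicCompletion K) (w.adicCompletion L) :=
    .of_algebraMap_eq fun x ↦ by
      rw [RingHom.algebraMap_toAlgebra, finiteCompletionMap_algebraMap]
      exact IsScalarTower.algebraMap_apply K L (w.adicCompletion L) x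
  infer_instance

open scoped Valued in
theorem continuous_finiteLocalNorm : Continuous (finiteLocalNorm v w) := by
  let _ := finiteCompletionAlgebra v w
  have : ContinuousSMul (v.adicCompletion K) (w.adicCompletion L) :=
    ⟨((continuous_finiteCompletionMap v w).comp continuous_fst).mul continuous_snd⟩
  have := finite_finiteCompletionAlgebra v w
  let b := Module.finBasis (v.adicCompletion K) (w.adicCompletion L)
  have h : (finiteLocalNorm v w : w.adicCompletion L → v.adicCompletion K) =
      fun x ↦ (Algebra.leftMulMatrix b x).det :=
    funext fun x ↦ Algebra.norm_eq_matrix_det b x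
  rw [h]
  refine Continuous.matrix_det ?_
  exact LinearMap.continuous_of_finiteDimensional (Algebra.leftMulMatrix b).toLinearMap

theorem finiteLocalNorm_mem_integers {x : w.adicCompletion L}
    (hx : x ∈ w.adicCompletionIntegers L) :
    finiteLocalNorm v w x ∈ v.adicCompletionIntegers K := by
  have h0 : finiteLocalNorm v w 0 = 0 := by
    let _ := finiteCompletionAlgebra v w
    have := finite_finiteCompletionAlgebra v w
    exact Algebra.norm_zero
  have hU : finiteLocalNorm v w ⁻¹' (v.adicCompletionIntegers K : Set (v.adicCompletion K)) ∈
      nhds 0 := by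
    refine (continuous_finiteLocalNorm v w).continuousAt.preimage_mem_nhds ?_
    rw [h0]
    exact (Valued.isOpen_valuationSubring _).mem_nhds (zero_mem _)
  -- a nonzero `c` such that `c * O_w` is mapped into `O_v`
  obtain ⟨c, hc0, hc⟩ : ∃ c : w.adicCompletion L, c ≠ 0 ∧ ∀ y ∈ w.adicCompletionIntegers L,
      finiteLocalNorm v w (c * y) ∈ v.adicCompletionIntegers K := by
    obtain ⟨γ, hγ⟩ := (Valued.mem_nhds_zero).1 hU
    obtain ⟨r, s, hr, hs, hrs⟩ := Valuation.restrict_exists_div_eq Valued.v γ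
    rw [← map_div₀] at hrs
    obtain ⟨p, hp⟩ := valuedAdicCompletion_surjective L w (WithZero.exp (-1))
    have hp1 : Valued.v p < 1 := by
      rw [hp, ← WithZero.exp_zero, WithZero.exp_lt_exp]
      norm_num
    have hp0 : p ≠ 0 := by
      rintro rfl
      rw [map_zero] at hp
      exact WithZero.exp_ne_zero hp.symm
    have hrs0 : 0 < Valued.v (r / s) := by
      rw [map_div₀]
      exact div_pos hr hs
    refine ⟨p * (r / s), mul_ne_zero hp0 ((Valuation.pos_iff _).1 hrs0), fun y hy ↦ hγ ?_⟩
    change Valued.v.restrict (p * (r / s) * y) < γ.1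
    rw [← hrs, Valuation.restrict_lt_iff, mul_right_comm, map_mul, map_mul]
    refine mul_lt_of_lt_one_left hrs0 ?_
    exact mul_lt_one_of_lt_of_le hp1 ((mem_adicCompletionIntegers _ _ _).1 hy)
  have hNc : finiteLocalNorm v w c ≠ 0 := ((Units.mk0 c hc0).isUnit.map (finiteLocalNorm v w)).ne_zero
  by_contra hN
  rw [mem_adicCompletionIntegers, not_le] at hN
  obtain ⟨n, hn⟩ := MulArchimedean.arch (Valued.v (finiteLocalNorm v w c))⁻¹ hN
  have h1 := hc (x ^ (n + 1)) (pow_mem hx _)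
  rw [map_mul, map_pow, mem_adicCompletionIntegers, map_mul, map_pow] at h1
  have hpos : 0 < Valued.v (finiteLocalNorm v w c) := by
    simpa [zero_lt_iff] using hNc
  rw [inv_le_iff_one_le_mul₀ hpos] at hn
  rw [pow_succ, ← mul_assoc, mul_comm (Valued.v (finiteLocalNorm v w c))] at h1
  exact absurd (lt_of_lt_of_le hN (le_mul_of_one_le_left' hn)) (not_lt.2 h1)

/-- There are only finitely many primes of `L` above a prime `v` of `K`. -/
theorem finite_primesAbove (v : HeightOneSpectrum (𝓞 K)) :
    Finite {w : HeightOneSpectrum (𝓞 L) // w.asIdeal.LiesOver v.asIdeal} := by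
  have := v.isMaximal
  have : Finite (v.asIdeal.primesOver (𝓞 L)) :=
    (IsDedekindDomain.primesOver_finite v.asIdeal (𝓞 L)).to_subtype
  refine Finite.of_injective
    (fun w ↦ (⟨w.1.asIdeal, w.1.isPrime, w.2⟩ : v.asIdeal.primesOver (𝓞 L))) fun w w' h ↦ ?_
  exact Subtype.ext (HeightOneSpectrum.ext (congrArg Subtype.val h))

instance (v : HeightOneSpectrum (𝓞 K)) :
    Fintype {w : HeightOneSpectrum (𝓞 L) // w.asIdeal.LiesOver v.asIdeal} :=
  have := finite_primesAbove (L := L) v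
  Fintype.ofFinite _

end FinitePlaces

section Infinite

variable (v : InfinitePlace K) (w : InfinitePlace L) [w.LiesOver v]

open scoped NumberField.LiesOver in
/-- The local norm `N_{L_w / K_v} : L_w → K_v` at an infinite place, for the `K_v`-algebra
structure on `L_w` which extends `K → L` by continuity. -/
def infiniteLocalNorm : w.Completion →* v.Completion :=
  Algebra.norm v.Completion

end Infinite

/-! ### The idele norm -/

variable (K L)

open scoped Classical in
/-- The norm on infinite adeles: `N(x)_v = ∏_{w ∣ v} N_{L_w / K_v}(x_w)`. -/
def infiniteAdeleNorm : InfiniteAdeleRing L →* InfiniteAdeleRing K where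
  toFun x v := ∏ w : {w : InfinitePlace L // w.LiesOver v},
    haveI := w.2
    infiniteLocalNorm v w.1 (x w.1)
  map_one' := funext fun v ↦ Finset.prod_eq_one fun w _ ↦ map_one _
  map_mul' x y := funext fun v ↦ by
    refine Eq.trans (Finset.prod_congr rfl fun w _ ↦ ?_) Finset.prod_mul_distrib
    exact map_mul _ _ _

variable {K} in
/-- The component at a finite place `v` of the norm on finite adeles:
`N(x)_v = ∏_{w ∣ v} N_{L_w / K_v}(x_w)`. -/
def finiteAdeleNormAt (v : HeightOneSpectrum (𝓞 K)) :
    FiniteAdeleRing (𝓞 L) L →* v.adicCompletion K where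
  toFun x := ∏ w : {w : HeightOneSpectrum (𝓞 L) // w.asIdeal.LiesOver v.asIdeal},
    haveI := w.2
    finiteLocalNorm v w.1 (x w.1)
  map_one' := Finset.prod_eq_one fun w _ ↦ map_one _
  map_mul' x y := by
    refine Eq.trans (Finset.prod_congr rfl fun w _ ↦ ?_) Finset.prod_mul_distrib
    exact map_mul _ _ _

theorem eventually_finiteAdeleNormAt_mem (x : FiniteAdeleRing (𝓞 L) L) :
    ∀ᶠ v : HeightOneSpectrum (𝓞 K) in Filter.cofinite,
      finiteAdeleNormAt L v x ∈ v.adicCompletionIntegers K := by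
  have hfin : {w : HeightOneSpectrum (𝓞 L) | x w ∉ w.adicCompletionIntegers L}.Finite := x.2
  refine (hfin.image (fun w ↦ w.under (𝓞 K))).subset fun v hv ↦ ?_
  by_contra hv'
  refine hv (show finiteAdeleNormAt L v x ∈ v.adicCompletionIntegers K from
    prod_mem fun w _ ↦ ?_)
  have := w.2
  refine finiteLocalNorm_mem_integers v w.1 ?_
  by_contra hw
  exact hv' ⟨w.1, hw, HeightOneSpectrum.ext w.2.over.symm⟩

/-- The norm on finite adeles. -/
def finiteAdeleNorm : FiniteAdeleRing (𝓞 L) L →* FiniteAdeleRing (𝓞 K) K where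
  toFun x := ⟨fun v ↦ finiteAdeleNormAt L v x, eventually_finiteAdeleNormAt_mem K L x⟩
  map_one' := FiniteAdeleRing.ext K fun v ↦ map_one (finiteAdeleNormAt L v)
  map_mul' x y := FiniteAdeleRing.ext K fun v ↦ map_mul (finiteAdeleNormAt L v) x y

/-- The group of ideles of `K`. -/
abbrev Ideles (K : Type*) [Field K] [NumberField K] : Type _ := (AdeleRing (𝓞 K) K)ˣ

/-- The idele norm `N : 𝕀_L → 𝕀_K`, `N(x)_v = ∏_{w ∣ v} N_{L_w / K_v}(x_w)` at every finite or
infinite place `v` of `K`. -/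
def ideleNorm : Ideles L →* Ideles K :=
  Units.map ((infiniteAdeleNorm K L).prodMap (finiteAdeleNorm K L))

/-- The diagonally embedded subgroup `K^*` of the idele group of `K`. -/
def principalIdeles : Subgroup (Ideles K) :=
  (Units.map (algebraMap K (AdeleRing (𝓞 K) K)).toMonoidHom).range

/-- The subgroup `K^* N(𝕀_L)` of `𝕀_K`. -/
def normSubgroup : Subgroup (Ideles K) :=
  principalIdeles K ⊔ (ideleNorm K L).range

end NormIndex

end

/-!
Let `U ⊆ 𝕀_K` be the group of ideles which are units at all finite places. Sending an idele to its
fractional ideal embeds `𝕀_K / K^* U` in the ideal class group, so `K^* U` has finite index, and it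
suffices that `N(𝕀_L) ∩ U` has finite index in `U`. This can be tested place by place, provided that
the index is finite at every place and equal to `1` at almost every place.

If `w ∣ v` are finite places and `d = [L_w : K_v]`, the norms of units of `O_w` contain the `d`-th
powers of units of `O_v`. The latter form an open subgroup of a compact group, because `x ↦ x ^ d`
is a local homeomorphism at `1` in characteristic zero, so the index is finite. If moreover `w` is
unramified over `v` and the residue characteristic does not divide `d`, then every unit of `O_v` is
a norm: norms are surjective for finite fields, and a unit congruent to `1` is a `d`-th power by
Hensel's lemma, hence a norm from `O_v`. These conditions hold for all but finitely many `v`, since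
`d ≤ [L : K]`. At an infinite place the norms contain the squares.
-/

noncomputable section

namespace NormIndex

open NumberField IsDedekindDomain IsDedekindDomain.HeightOneSpectrum IsLocalRing Module
open scoped Topology

/-! ### Groups of finite index and products of homomorphisms -/

section Groups

theorem relIndex_iInf_iInf_ne_zero {G ι : Type*} [Group G] {H U : ι → Subgroup G}
    (hle : ∀ᶠ i in Filter.cofinite, U i ≤ H i) (hindex : ∀ i, (H i).relIndex (U i) ≠ 0) :
    (⨅ i, H i).relIndex (⨅ i, U i) ≠ 0 := by
  let S := {i | ¬ U i ≤ H i}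
  have : Finite S := Set.Finite.to_subtype hle
  have hS : (⨅ i : S, H i).relIndex (⨅ i, U i) ≠ 0 := Subgroup.relIndex_iInf_ne_zero fun i ↦
    mt (Subgroup.relIndex_eq_zero_of_le_right (iInf_le U i)) (hindex i)
  rw [← Subgroup.inf_relIndex_right] at hS
  refine mt (Subgroup.relIndex_eq_zero_of_le_left (le_iInf fun i ↦ ?_)) hS
  by_cases hi : U i ≤ H i
  · exact inf_le_right.trans ((iInf_le U i).trans hi)
  · exact inf_le_left.trans (iInf_le (fun i : S ↦ H i) ⟨i, hi⟩)

theorem finiteIndex_sup_of_relIndex_ne_zero {G : Type*} [CommGroup G] {P U N : Subgroup G}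
    (hPU : (P ⊔ U).FiniteIndex) (hNU : N.relIndex U ≠ 0) : (P ⊔ N).FiniteIndex := by
  have hrel : (P ⊔ N).relIndex (U ⊔ (P ⊔ N)) ≠ 0 := by
    rw [Subgroup.relIndex_sup_right]
    exact mt (Subgroup.relIndex_eq_zero_of_le_left le_sup_right) hNU
  have : (U ⊔ (P ⊔ N)).FiniteIndex :=
    Subgroup.finiteIndex_of_le (sup_le (le_sup_left.trans le_sup_right) le_sup_left)
  refine ⟨?_⟩
  rw [← Subgroup.relIndex_mul_index (le_sup_right : P ⊔ N ≤ U ⊔ (P ⊔ N))]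
  exact mul_ne_zero hrel Subgroup.FiniteIndex.index_ne_zero

theorem iSup_range_eq_range_prod {ι G : Type*} {F : ι → Type*} [Fintype ι] [∀ i, Group (F i)]
    [CommGroup G] (f : ∀ i, F i →* G) :
    ⨆ i, (f i).range = (∏ i, (f i).comp (Pi.evalMonoidHom F i)).range := by
  classical
  apply le_antisymm
  · refine iSup_le fun i ↦ ?_
    rintro _ ⟨y, rfl⟩
    refine ⟨Pi.mulSingle i y, ?_⟩
    rw [MonoidHom.finsetProd_apply, Fintype.prod_eq_single i fun j hj ↦ ?_]
    · simp
    · simp [Pi.mulSingle_eq_of_ne hj]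
  · rintro _ ⟨y, rfl⟩
    rw [MonoidHom.finsetProd_apply]
    exact prod_mem fun i _ ↦ Subgroup.mem_iSup_of_mem i ⟨y i, rfl⟩

theorem exists_forall_prod_fiber_eq {ι κ : Type*} {r : ι → κ → Prop} (hr : Relator.RightUnique r)
    (hr' : ∀ i, ∃ k, r i k) [∀ k, Fintype {i // r i k}] {F : ι → Type*} {G : κ → Type*}
    [∀ i, Group (F i)] [∀ k, CommGroup (G k)] {N : ∀ i k, r i k → F i →* G k} {x : ∀ k, G k}
    (hx : ∀ k, x k ∈ ⨆ i : {i // r i k}, (N i.1 k i.2).range) :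
    ∃ y : ∀ i, F i, ∀ k, ∏ i : {i // r i k}, N i.1 k i.2 (y i) = x k := by
  simp only [iSup_range_eq_range_prod, MonoidHom.mem_range, MonoidHom.finsetProd_apply] at hx
  choose y hy using hx
  choose k hk using hr'
  refine ⟨fun i ↦ y (k i) ⟨i, hk i⟩, fun k' ↦ (hy k').symm ▸ Finset.prod_congr rfl ?_⟩
  rintro ⟨i, hi⟩ -
  obtain rfl := hr (hk i) hi
  rfl

end Groups

/-! ### Norms over local rings -/

section LocalRings

variable {R S : Type*} [CommRing R] [CommRing S] [Algebra R S]

theorem exists_pow_eq_of_sub_one_mem {I : Ideal R} [HenselianRing R I] {d : ℕ}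
    (hd : IsUnit (d : R)) {u : R} (hu : u - 1 ∈ I) : ∃ z : R, z ^ d = u := by
  rcases eq_or_ne d 0 with rfl | hd0
  · have : Subsingleton R := subsingleton_of_zero_eq_one (isUnit_zero_iff.1 (by simpa using hd))
    exact ⟨u, Subsingleton.elim _ _⟩
  obtain ⟨z, hz, -⟩ := HenselianRing.is_henselian (I := I)
    (Polynomial.X ^ d - Polynomial.C u) (Polynomial.monic_X_pow_sub_C u hd0) 1
    (by simpa using neg_mem hu)
    (by simpa [Polynomial.derivative_X_pow] using hd.map (Ideal.Quotient.mk I))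
  exact ⟨z, by simpa [Polynomial.IsRoot, sub_eq_zero] using hz⟩

theorem isUnit_norm_iff [Module.Free R S] [Module.Finite R S] {x : S} :
    IsUnit (Algebra.norm R x) ↔ IsUnit x :=
  (LinearMap.isUnit_iff_isUnit_det _).symm.trans Algebra.lmul_isUnit_iff

theorem range_powMonoidHom_le_range_unitsMap_norm [Nontrivial R] [Module.Free R S]
    [Module.Finite R S] :
    (powMonoidHom (finrank R S) : Rˣ →* Rˣ).range ≤
      (Units.map (Algebra.norm R : S →* R)).range := by
  rintro _ ⟨u, rfl⟩
  refine ⟨Units.map (algebraMap R S) u, Units.ext ?_⟩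
  simp [Algebra.norm_algebraMap_of_basis (Free.chooseBasis R S), finrank_eq_card_chooseBasisIndex]

variable [IsLocalRing R] [Module.Free R S] [Module.Finite R S]

theorem leftMulMatrix_basisQuotient {ι : Type*} [Fintype ι] [DecidableEq ι] (b : Basis ι R S)
    (x : S) :
    letI := Ideal.Quotient.field (maximalIdeal R)
    Algebra.leftMulMatrix (basisQuotient b)
        (Ideal.Quotient.mk ((maximalIdeal R).map (algebraMap R S)) x) =
      (Ideal.Quotient.mk (maximalIdeal R)).mapMatrix (Algebra.leftMulMatrix b x) := by
  ext i j
  simp only [Algebra.leftMulMatrix_eq_repr_mul, basisQuotient_apply, ← map_mul,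
    basisQuotient_repr, RingHom.mapMatrix_apply, Matrix.map_apply]

theorem norm_quotient_mk (x : S) :
    letI := Ideal.Quotient.field (maximalIdeal R)
    Algebra.norm (R ⧸ maximalIdeal R)
        (Ideal.Quotient.mk ((maximalIdeal R).map (algebraMap R S)) x) =
      Ideal.Quotient.mk (maximalIdeal R) (Algebra.norm R x) := by
  classical
  rw [Algebra.norm_eq_matrix_det (Free.chooseBasis R S), RingHom.map_det,
    ← leftMulMatrix_basisQuotient, ← Algebra.norm_eq_matrix_det]

variable [Finite (ResidueField R)] [IsLocalRing S]

theorem exists_norm_sub_mem_maximalIdeal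
    (hS : (maximalIdeal R).map (algebraMap R S) = maximalIdeal S) (u : R) :
    ∃ y : S, Algebra.norm R y - u ∈ maximalIdeal R := by
  let _ := Ideal.Quotient.field (maximalIdeal R)
  have : ((maximalIdeal R).map (algebraMap R S)).IsMaximal := hS ▸ inferInstance
  let _ := Ideal.Quotient.field ((maximalIdeal R).map (algebraMap R S))
  have : Finite (R ⧸ maximalIdeal R) := ‹Finite (ResidueField R)›
  have : Module.Finite (R ⧸ maximalIdeal R) (S ⧸ (maximalIdeal R).map (algebraMap R S)) :=
    .of_restrictScalars_finite R _ _
  have : Finite (S ⧸ (maximalIdeal R).map (algebraMap R S)) :=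
    Module.finite_of_finite (R ⧸ maximalIdeal R)
  obtain ⟨t, ht⟩ := FiniteField.norm_surjective (R ⧸ maximalIdeal R)
    (S ⧸ (maximalIdeal R).map (algebraMap R S)) (Ideal.Quotient.mk _ u)
  obtain ⟨y, rfl⟩ := Ideal.Quotient.mk_surjective t
  exact ⟨y, Ideal.Quotient.eq.1 ((norm_quotient_mk y).symm.trans ht)⟩

theorem unitsMap_norm_surjective [HenselianRing R (maximalIdeal R)]
    (hS : (maximalIdeal R).map (algebraMap R S) = maximalIdeal S)
    (hd : IsUnit (finrank R S : R)) :
    Function.Surjective (Units.map (Algebra.norm R : S →* R)) := by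
  -- A norm agrees with `u` modulo the maximal ideal, and the remaining factor `c⁻¹ * u`, being
  -- congruent to `1`, is a `finrank R S`-th power in `R`, hence the norm of an element of `R`.
  intro u
  obtain ⟨y, hy⟩ := exists_norm_sub_mem_maximalIdeal hS (u : R)
  have hNy : IsUnit (Algebra.norm R y) := by
    by_contra h
    exact (mem_maximalIdeal _).1
      ((Submodule.sub_mem_iff_right _ ((mem_maximalIdeal _).2 h)).1 hy) u.isUnit
  obtain ⟨y, rfl⟩ := isUnit_norm_iff.1 hNy
  let c : Rˣ := Units.map (Algebra.norm R : S →* R) y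
  obtain ⟨z, hz⟩ := exists_pow_eq_of_sub_one_mem hd (u := ↑(c⁻¹ * u)) (I := maximalIdeal R) <| by
    have h : (↑(c⁻¹ * u) - 1 : R) = -(↑c⁻¹ * (Algebra.norm R (y : S) - u)) := by
      rw [mul_sub, show Algebra.norm R (y : S) = c from rfl, Units.inv_mul, Units.val_mul, neg_sub]
    rw [h]
    exact neg_mem (Ideal.mul_mem_left _ _ hy)
  have hz_norm : Algebra.norm R (algebraMap R S z) = ↑(c⁻¹ * u) := by
    rw [Algebra.norm_algebraMap_of_basis (Free.chooseBasis R S),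
      ← finrank_eq_card_chooseBasisIndex, hz]
  obtain ⟨s, hs⟩ := isUnit_norm_iff.1 (hz_norm ▸ (c⁻¹ * u).isUnit)
  refine ⟨y * s, ?_⟩
  rw [map_mul, ← inv_mul_eq_iff_eq_mul.1 (Units.ext (hz_norm.symm.trans (hs ▸ rfl)))]

end LocalRings
/-! ### Completions at finite places -/

theorem isPrecomplete_of_compactSpace {R : Type*} [CommRing R] [TopologicalSpace R]
    [IsTopologicalRing R] [T2Space R] [CompactSpace R] [IsNoetherianRing R] (I : Ideal R) :
    IsPrecomplete I R where
  prec' f hf := by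
    obtain ⟨x, hx⟩ := exists_clusterPt_of_compactSpace (Filter.map f Filter.atTop)
    refine ⟨x, fun n ↦ ?_⟩
    have hclosed : IsClosed {y | f n - y ∈ (I ^ n • ⊤ : Ideal R)} :=
      (IsNoetherianRing.isClosed_ideal _).preimage (continuous_const.sub continuous_id)
    have hmem : ∀ᶠ m in Filter.atTop, f n - f m ∈ (I ^ n • ⊤ : Ideal R) :=
      (Filter.eventually_ge_atTop n).mono fun m hm ↦ SModEq.sub_mem.1 (hf hm)
    exact SModEq.sub_mem.2 (hclosed.closure_subset (hx.mem_closure_of_mem _ hmem))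

theorem map_pow_nhds_one {𝕜 : Type*} [NontriviallyNormedField 𝕜] [CompleteSpace 𝕜] {d : ℕ}
    (hd : (d : 𝕜) ≠ 0) : Filter.map (fun x : 𝕜 ↦ x ^ d) (𝓝 1) = 𝓝 1 := by
  simpa using (hasStrictDerivAt_pow d (1 : 𝕜)).map_nhds_eq (by simpa using hd)

theorem eventually_notMem_asIdeal {R : Type*} [CommRing R] [IsDedekindDomain R] {a : R}
    (ha : a ≠ 0) : ∀ᶠ v : HeightOneSpectrum R in Filter.cofinite, a ∉ v.asIdeal := by
  refine (Ideal.finite_factors (I := Ideal.span {a}) (by simpa using ha)).subset fun v hv ↦ ?_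
  exact Ideal.dvd_span_singleton.2 (not_not.1 hv)

section Completion

variable {R K : Type*} [CommRing R] [IsDedekindDomain R] [Field K] [Algebra R K]
  [IsFractionRing R K] (v : HeightOneSpectrum R)

open scoped WithZeroTopology in
theorem isOpen_setOf_valued_sub_lt (x : v.adicCompletion K) (γ : WithZero (Multiplicative ℤ)) :
    IsOpen {z : v.adicCompletion K | Valued.v (x - z) < γ} :=
  WithZeroTopology.isOpen_Iio.preimage <|
    (Valued.continuous_valuation_of_surjective (valuedAdicCompletion_surjective K v)).comp
      (continuous_const.sub continuous_id)

theorem valued_algebraMap (y : K) :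
    Valued.v (algebraMap K (v.adicCompletion K) y) = v.valuation K y :=
  valuedAdicCompletion_eq_valuation' v y

theorem exists_valued_sub_algebraMap_lt (x : v.adicCompletion K)
    {γ : WithZero (Multiplicative ℤ)} (hγ : γ ≠ 0) :
    ∃ y : K, Valued.v (x - algebraMap K (v.adicCompletion K) y) < γ :=
  (denseRange_algebraMap K v).exists_mem_open (isOpen_setOf_valued_sub_lt v x γ)
    ⟨x, by simpa using hγ.bot_lt⟩

theorem mem_maximalIdeal_adicCompletionIntegers_iff {x : v.adicCompletionIntegers K} :
    x ∈ maximalIdeal (v.adicCompletionIntegers K) ↔ Valued.v (x : v.adicCompletion K) < 1 :=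
  Valued.v.mem_maximalIdeal_iff

variable (K) in
theorem residue_comp_algebraMap_surjective :
    Function.Surjective ((residue (v.adicCompletionIntegers K)).comp
      (algebraMap R (v.adicCompletionIntegers K))) := by
  intro t
  obtain ⟨x, rfl⟩ := residue_surjective t
  obtain ⟨y, hxy⟩ := exists_valued_sub_algebraMap_lt v (x : v.adicCompletion K) one_ne_zero
  have hy : v.valuation K y ≤ 1 := by
    rw [← valued_algebraMap,
      ← sub_sub_cancel (x : v.adicCompletion K) (algebraMap K (v.adicCompletion K) y)]
    exact (Valued.v.map_sub _ _).trans (max_le x.2 hxy.le)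
  obtain ⟨a, hay⟩ := exists_valuation_sub_lt_of_integer v hy 1
  rw [← valued_algebraMap, map_sub] at hay
  refine ⟨a, ?_⟩
  rw [RingHom.comp_apply, ← sub_eq_zero, ← map_sub, residue_eq_zero_iff,
    mem_maximalIdeal_adicCompletionIntegers_iff]
  rw [Valuation.map_sub_swap] at hxy
  have h := (Valued.v.map_add _ _).trans_lt (max_lt hay hxy)
  rwa [sub_add_sub_cancel] at h

instance finite_residueField_adicCompletionIntegers [Finite (R ⧸ v.asIdeal)] :
    Finite (ResidueField (v.adicCompletionIntegers K)) := by
  refine Finite.of_surjective (Ideal.Quotient.lift v.asIdeal _ fun a ha ↦ ?_)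
    (Ideal.Quotient.lift_surjective_of_surjective _ _ (residue_comp_algebraMap_surjective K v))
  rw [RingHom.comp_apply, residue_eq_zero_iff, mem_maximalIdeal_adicCompletionIntegers_iff]
  exact (valuedAdicCompletion_eq_valuation v a).trans_lt ((valuation_lt_one_iff_mem v a).2 ha)

theorem exists_valued_eq_exp_neg_one :
    ∃ p : v.adicCompletionIntegers K, Valued.v (p : v.adicCompletion K) = WithZero.exp (-1) := by
  obtain ⟨p, hp⟩ := valuedAdicCompletion_surjective K v (WithZero.exp (-1))
  refine ⟨⟨p, (mem_adicCompletionIntegers _ _ _).2 ?_⟩, hp⟩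
  rw [hp, ← WithZero.exp_zero, WithZero.exp_le_exp]
  norm_num

theorem valued_natCast_eq_one_of_dvd {m n : ℕ} (hmn : m ∣ n) (hn : (n : R) ∉ v.asIdeal) :
    Valued.v (m : v.adicCompletion K) = 1 := by
  have hm : (m : R) ∉ v.asIdeal := fun h ↦ hn (v.asIdeal.mem_of_dvd (Nat.cast_dvd_cast hmn) h)
  rwa [← valuation_eq_one_iff_notMem (K := K), map_natCast (algebraMap R K),
    ← valued_algebraMap, map_natCast (algebraMap K (v.adicCompletion K))] at hm

end Completion

section NumberField

variable {K : Type*} [Field K] [NumberField K] (v : HeightOneSpectrum (𝓞 K))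

instance : Finite (𝓞 K ⧸ v.asIdeal) := v.asIdeal.finiteQuotientOfFreeOfNeBot v.ne_bot

instance compactSpace_adicCompletionIntegers : CompactSpace (v.adicCompletionIntegers K) :=
  open Valued.integer in
  compactSpace_iff_completeSpace_and_isDiscreteValuationRing_and_finite_residueField.2
    ⟨(Valued.isClosed_integer (v.adicCompletion K)).completeSpace_coe,
      inferInstanceAs (IsDiscreteValuationRing (v.adicCompletionIntegers K)),
      finite_residueField_adicCompletionIntegers v⟩

instance isAdicComplete_adicCompletionIntegers :
    IsAdicComplete (maximalIdeal (v.adicCompletionIntegers K)) (v.adicCompletionIntegers K) where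
  toIsPrecomplete := isPrecomplete_of_compactSpace _

open scoped Valued in
theorem isOpen_range_powMonoidHom {d : ℕ} (hd : d ≠ 0) :
    IsOpen ((powMonoidHom d : (v.adicCompletionIntegers K)ˣ →* _).range :
      Set (v.adicCompletionIntegers K)ˣ) := by
  have : CharZero (v.adicCompletion K) := algebraRat.charZero _
  have hopen := isOpen_setOf_valued_sub_lt v (1 : v.adicCompletion K) 1
  have hpow : (fun z ↦ z ^ d) '' {z : v.adicCompletion K | Valued.v (1 - z) < 1} ∈ 𝓝 1 := by
    rw [← map_pow_nhds_one (𝕜 := v.adicCompletion K) (Nat.cast_ne_zero.2 hd)]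
    exact Filter.image_mem_map (hopen.mem_nhds (by simp))
  have hcont : Continuous fun u : (v.adicCompletionIntegers K)ˣ ↦
      ((u : v.adicCompletionIntegers K) : v.adicCompletion K) :=
    continuous_subtype_val.comp Units.continuous_val
  refine Subgroup.isOpen_of_mem_nhds _ (g := 1) ?_
  filter_upwards [hcont.continuousAt.preimage_mem_nhds (x := 1) hpow]
  rintro u ⟨z, hz, hzu⟩
  have hz1 : Valued.v z = 1 := by
    rw [← sub_sub_cancel 1 z, Valued.v.map_sub_eq_of_lt_left (by simpa using hz), map_one]
  refine ⟨(adicCompletionIntegers.isUnit_iff_valued_eq_one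
    (a := ⟨z, (mem_adicCompletionIntegers _ _ _).2 hz1.le⟩)).2 hz1 |>.unit, ?_⟩
  exact Units.ext (Subtype.ext hzu)

theorem finiteIndex_range_powMonoidHom {d : ℕ} (hd : d ≠ 0) :
    (powMonoidHom d : (v.adicCompletionIntegers K)ˣ →* _).range.FiniteIndex := by
  have := Subgroup.quotient_finite_of_isOpen _ (isOpen_range_powMonoidHom v hd)
  exact Subgroup.finiteIndex_of_finite_quotient

end NumberField
theorem lt_one_iff_le_exp_neg_one {x : WithZero (Multiplicative ℤ)} :
    x < 1 ↔ x ≤ WithZero.exp (-1) := by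
  rw [← WithZero.lt_mul_exp_iff_le WithZero.exp_ne_zero, ← WithZero.exp_add, neg_add_cancel,
    WithZero.exp_zero]

/-! ### Local norms at finite places -/

section Extension

variable {K L : Type*} [Field K] [NumberField K] [Field L] [NumberField L] [Algebra K L]
  (v : HeightOneSpectrum (𝓞 K)) (w : HeightOneSpectrum (𝓞 L)) [w.asIdeal.LiesOver v.asIdeal]

attribute [local instance] finiteCompletionAlgebra finite_finiteCompletionAlgebra

open scoped WithZeroTopology in
theorem valued_finiteCompletionMap (x : v.adicCompletion K) :
    Valued.v (finiteCompletionMap v w x) =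
      Valued.v x ^ v.asIdeal.ramificationIdx' w.asIdeal := by
  have hcontK : Continuous (Valued.v : Valuation (v.adicCompletion K) _) :=
    Valued.continuous_valuation_of_surjective (valuedAdicCompletion_surjective K v)
  have hcontL : Continuous (Valued.v : Valuation (w.adicCompletion L) _) :=
    Valued.continuous_valuation_of_surjective (valuedAdicCompletion_surjective L w)
  refine congrFun ((denseRange_algebraMap K v).equalizer
    (hcontL.comp (continuous_finiteCompletionMap v w)) (hcontK.pow _) (funext fun y ↦ ?_)) x
  simp only [Function.comp_apply, Pi.pow_apply, finiteCompletionMap_algebraMap, valued_algebraMap,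
    valuation_liesOver L v w]

theorem isScalarTower_finiteCompletionAlgebra :
    IsScalarTower K (v.adicCompletion K) (w.adicCompletion L) :=
  .of_algebraMap_eq fun x ↦ by
    rw [RingHom.algebraMap_toAlgebra, finiteCompletionMap_algebraMap]
    exact IsScalarTower.algebraMap_apply K L (w.adicCompletion L) x

theorem continuousSMul_finiteCompletionAlgebra :
    ContinuousSMul (v.adicCompletion K) (w.adicCompletion L) :=
  ⟨((continuous_finiteCompletionMap v w).comp continuous_fst).mul continuous_snd⟩

attribute [local instance] isScalarTower_finiteCompletionAlgebra
  continuousSMul_finiteCompletionAlgebra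

open scoped TensorProduct Valued in
theorem finrank_adicCompletion_le :
    finrank (v.adicCompletion K) (w.adicCompletion L) ≤ finrank K L := by
  -- The image of `K_v ⊗ L` in `L_w` is dense, and closed since it is finite-dimensional over `K_v`.
  let Φ : v.adicCompletion K ⊗[K] L →ₗ[v.adicCompletion K] w.adicCompletion L :=
    (Algebra.TensorProduct.lift
      (Algebra.algHom (v.adicCompletion K) (v.adicCompletion K) (w.adicCompletion L))
      (Algebra.algHom K L (w.adicCompletion L)) (fun _ _ ↦ mul_comm ..)).toLinearMap
  have hdense : DenseRange Φ := by
    apply (w.denseRange_algebraMap L).mono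
    rintro _ ⟨l, rfl⟩
    exact ⟨1 ⊗ₜ l, by simp [Φ, Algebra.algHom]⟩
  have hsurj : LinearMap.range Φ = ⊤ := by
    rw [← SetLike.coe_set_eq, ← Φ.range.closed_of_finiteDimensional.closure_eq]
    exact hdense.closure_range
  rw [← finrank_top, ← hsurj, ← Module.finrank_baseChange (R := v.adicCompletion K) (M' := L)]
  exact LinearMap.finrank_range_le Φ

/-- The inclusion `O_v → O_w` of the rings of integers of `K_v` and `L_w`. -/
def finiteIntegersMap : v.adicCompletionIntegers K →+* w.adicCompletionIntegers L :=
  (finiteCompletionMap v w).restrict (v.adicCompletionIntegers K) (w.adicCompletionIntegers L)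
    fun x hx ↦ by
      rw [mem_adicCompletionIntegers] at hx ⊢
      rw [valued_finiteCompletionMap]
      exact pow_le_one' hx _

/-- `O_w` as an `O_v`-algebra, through `finiteIntegersMap`. -/
abbrev finiteIntegersAlgebra :
    Algebra (v.adicCompletionIntegers K) (w.adicCompletionIntegers L) :=
  (finiteIntegersMap v w).toAlgebra

attribute [local instance] finiteIntegersAlgebra

theorem isScalarTower_finiteIntegersAlgebra :
    IsScalarTower (v.adicCompletionIntegers K) (w.adicCompletionIntegers L)
      (w.adicCompletion L) :=
  .of_algebraMap_eq fun _ ↦ rfl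

attribute [local instance] isScalarTower_finiteIntegersAlgebra

open scoped Valued in
theorem exists_forall_mul_mem {s : Set (w.adicCompletion L)} (hs : s ∈ 𝓝 0) :
    ∃ c : w.adicCompletion L, c ≠ 0 ∧ ∀ y : w.adicCompletionIntegers L, c * y ∈ s := by
  have h : ∀ᶠ c in 𝓝 (0 : w.adicCompletion L), ∀ y ∈ (Set.univ : Set (w.adicCompletionIntegers L)),
      c * (y : w.adicCompletion L) ∈ s := by
    refine isCompact_univ.eventually_forall_of_forall_eventually fun y _ ↦ ?_
    have hcont : Continuous fun p : w.adicCompletion L × w.adicCompletionIntegers L ↦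
      p.1 * (p.2 : w.adicCompletion L) := by fun_prop
    exact (hcont.continuousAt (x := (0, y))).eventually_mem (by rwa [zero_mul])
  obtain ⟨c, hc, hc0⟩ := ((h.filter_mono nhdsWithin_le_nhds).and
    (self_mem_nhdsWithin : {0}ᶜ ∈ 𝓝[≠] (0 : w.adicCompletion L))).exists
  exact ⟨c, hc0, fun y ↦ hc y trivial⟩

open scoped Valued in
theorem finite_finiteIntegersAlgebra :
    Module.Finite (v.adicCompletionIntegers K) (w.adicCompletionIntegers L) := by
  let b := finBasis (v.adicCompletion K) (w.adicCompletion L)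
  have hcont : Continuous b.equivFun :=
    LinearMap.continuous_of_finiteDimensional b.equivFun.toLinearMap
  have hnhds : b.equivFun ⁻¹' Set.univ.pi (fun _ ↦ (v.adicCompletionIntegers K : Set _)) ∈ 𝓝 0 := by
    refine hcont.continuousAt.preimage_mem_nhds ?_
    rw [map_zero]
    exact set_pi_mem_nhds Set.finite_univ fun _ _ ↦
      (Valued.isOpen_valuationSubring _).mem_nhds (zero_mem _)
  obtain ⟨c, hc0, hc⟩ := exists_forall_mul_mem w hnhds
  let f : w.adicCompletionIntegers L →ₗ[v.adicCompletionIntegers K] w.adicCompletion L :=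
    LinearMap.mulLeft _ c ∘ₗ (IsScalarTower.toAlgHom _ _ _).toLinearMap
  have hf (y) : f y ∈ Submodule.span (v.adicCompletionIntegers K) (Set.range b) :=
    (b.mem_span_iff_repr_mem _ _).2 fun i ↦ ⟨⟨_, hc y i trivial⟩, rfl⟩
  have := Module.Finite.span_of_finite (v.adicCompletionIntegers K) (Set.finite_range b)
  exact Module.Finite.of_injective (f.codRestrict _ hf) fun x y hxy ↦
    Subtype.ext (mul_left_cancel₀ hc0 (congrArg Subtype.val hxy))

attribute [local instance] finite_finiteIntegersAlgebra

theorem free_finiteIntegersAlgebra :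
    Module.Free (v.adicCompletionIntegers K) (w.adicCompletionIntegers L) := by
  have : FaithfulSMul (v.adicCompletionIntegers K) (w.adicCompletionIntegers L) :=
    (faithfulSMul_iff_algebraMap_injective _ _).2 fun x y h ↦
      Subtype.ext ((finiteCompletionMap v w).injective (congrArg Subtype.val h))
  have : Module.IsTorsionFree (v.adicCompletionIntegers K) (w.adicCompletionIntegers L) :=
    inferInstance
  infer_instance

attribute [local instance] free_finiteIntegersAlgebra

theorem isLocalization_finiteIntegersAlgebra :
    IsLocalization (Algebra.algebraMapSubmonoid (w.adicCompletionIntegers L)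
      (nonZeroDivisors (v.adicCompletionIntegers K))) (w.adicCompletion L) :=
  IsIntegralClosure.isLocalization (v.adicCompletionIntegers K) (v.adicCompletion K)
    (w.adicCompletion L) (w.adicCompletionIntegers L)

attribute [local instance] isLocalization_finiteIntegersAlgebra

theorem finrank_adicCompletionIntegers :
    finrank (v.adicCompletionIntegers K) (w.adicCompletionIntegers L) =
      finrank (v.adicCompletion K) (w.adicCompletion L) := by
  rw [finrank_eq_card_chooseBasisIndex, finrank_eq_card_basis
    ((Free.chooseBasis (v.adicCompletionIntegers K)
      (w.adicCompletionIntegers L)).localizationLocalization (v.adicCompletion K)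
        (nonZeroDivisors (v.adicCompletionIntegers K)) (w.adicCompletion L))]

/-- The norm `O_w → O_v` of the rings of integers, the restriction of `finiteLocalNorm`. -/
def finiteIntegersNorm : w.adicCompletionIntegers L →* v.adicCompletionIntegers K :=
  Algebra.norm (v.adicCompletionIntegers K)

theorem coe_finiteIntegersNorm (y : w.adicCompletionIntegers L) :
    (finiteIntegersNorm v w y : v.adicCompletion K) = finiteLocalNorm v w y :=
  (Algebra.norm_localization (v.adicCompletionIntegers K)
    (nonZeroDivisors (v.adicCompletionIntegers K)) (Rₘ := v.adicCompletion K)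
    (Sₘ := w.adicCompletion L) y).symm

theorem finiteIndex_range_unitsMap_finiteIntegersNorm :
    (Units.map (finiteIntegersNorm v w)).range.FiniteIndex :=
  have := finiteIndex_range_powMonoidHom v
    (finrank_pos (R := v.adicCompletionIntegers K) (M := w.adicCompletionIntegers L)).ne'
  Subgroup.finiteIndex_of_le range_powMonoidHom_le_range_unitsMap_norm

theorem map_maximalIdeal_eq_of_ramificationIdx_eq_one
    (he : v.asIdeal.ramificationIdx' w.asIdeal = 1) :
    (maximalIdeal (v.adicCompletionIntegers K)).map
        (algebraMap _ (w.adicCompletionIntegers L)) =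
      maximalIdeal (w.adicCompletionIntegers L) := by
  have hval (x : v.adicCompletionIntegers K) :
      Valued.v (algebraMap _ (w.adicCompletionIntegers L) x : w.adicCompletion L) =
        Valued.v (x : v.adicCompletion K) :=
    (valued_finiteCompletionMap v w x).trans (by rw [he, pow_one])
  refine le_antisymm (Ideal.map_le_iff_le_comap.2 fun x hx ↦ ?_) fun x hx ↦ ?_
  · rw [mem_maximalIdeal_adicCompletionIntegers_iff] at hx
    rwa [Ideal.mem_comap, mem_maximalIdeal_adicCompletionIntegers_iff, hval]
  · obtain ⟨p, hp⟩ := exists_valued_eq_exp_neg_one (K := K) v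
    have hp_mem : p ∈ maximalIdeal (v.adicCompletionIntegers K) :=
      (mem_maximalIdeal_adicCompletionIntegers_iff v).2 (lt_one_iff_le_exp_neg_one.2 hp.le)
    refine Ideal.mem_of_dvd _ ((adicCompletionIntegers.integers L w).dvd_of_le ?_)
      (Ideal.mem_map_of_mem _ hp_mem)
    exact (lt_one_iff_le_exp_neg_one.1
      ((mem_maximalIdeal_adicCompletionIntegers_iff w).1 hx)).trans_eq (hp.symm.trans (hval p).symm)

theorem unitsMap_finiteIntegersNorm_surjective (he : v.asIdeal.ramificationIdx' w.asIdeal = 1)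
    (hd : Valued.v (finrank (v.adicCompletion K) (w.adicCompletion L) : v.adicCompletion K) = 1) :
    Function.Surjective (Units.map (finiteIntegersNorm v w)) :=
  unitsMap_norm_surjective (map_maximalIdeal_eq_of_ramificationIdx_eq_one v w he) <| by
    rw [finrank_adicCompletionIntegers, adicCompletionIntegers.isUnit_iff_valued_eq_one]
    exact_mod_cast hd

theorem eventually_ramificationIdx_eq_one (K L : Type*) [Field K] [NumberField K] [Field L]
    [NumberField L] [Algebra K L] :
    ∀ᶠ v : HeightOneSpectrum (𝓞 K) in Filter.cofinite, ∀ w : HeightOneSpectrum (𝓞 L),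
      w.asIdeal.LiesOver v.asIdeal → v.asIdeal.ramificationIdx' w.asIdeal = 1 := by
  have hd : differentIdeal (𝓞 K) (𝓞 L) ≠ ⊥ := differentIdeal_ne_bot
  refine ((Ideal.finite_factors hd).image fun w ↦ w.under (𝓞 K)).subset fun v hv ↦ ?_
  obtain ⟨w, hw, he⟩ : ∃ w : HeightOneSpectrum (𝓞 L),
      w.asIdeal.LiesOver v.asIdeal ∧ v.asIdeal.ramificationIdx' w.asIdeal ≠ 1 := by
    simpa using hv
  refine ⟨w, ?_, HeightOneSpectrum.ext hw.over.symm⟩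
  have hle : v.asIdeal.map (algebraMap (𝓞 K) (𝓞 L)) ≤ w.asIdeal :=
    Ideal.map_le_iff_le_comap.2 hw.over.le
  have hle_sq : v.asIdeal.map (algebraMap (𝓞 K) (𝓞 L)) ≤ w.asIdeal ^ 2 := by
    by_contra h
    exact he (Ideal.ramificationIdx'_spec (by rwa [pow_one]) h)
  have := v.isMaximal
  have := w.isPrime
  simpa using pow_sub_one_dvd_differentIdeal (𝓞 K) w.asIdeal 2 v.ne_bot (Ideal.dvd_iff_le.2 hle_sq)

theorem eventually_unitsMap_finiteIntegersNorm_surjective (K L : Type*) [Field K] [NumberField K]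
    [Field L] [NumberField L] [Algebra K L] :
    ∀ᶠ v : HeightOneSpectrum (𝓞 K) in Filter.cofinite,
      ∀ (w : HeightOneSpectrum (𝓞 L)) (_ : w.asIdeal.LiesOver v.asIdeal),
        Function.Surjective (Units.map (finiteIntegersNorm v w)) := by
  filter_upwards [eventually_ramificationIdx_eq_one K L,
    eventually_notMem_asIdeal (Nat.cast_ne_zero.2 (finrank K L).factorial_ne_zero)]
    with v hram hres w hw
  exact unitsMap_finiteIntegersNorm_surjective v w (hram w hw) <| valued_natCast_eq_one_of_dvd v
    (Nat.dvd_factorial finrank_pos (finrank_adicCompletion_le v w)) hres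

end Extension

/-! ### Local norms at infinite places -/

section InfinitePlaces

theorem finiteIndex_range_powMonoidHom_two {F : Type*} [Field F]
    (h : ∀ x : F, IsSquare x ∨ IsSquare (-x)) :
    (powMonoidHom 2 : Fˣ →* Fˣ).range.FiniteIndex := by
  have mem_range_of_isSquare (x : Fˣ) (hx : IsSquare (x : F)) :
      x ∈ (powMonoidHom 2 : Fˣ →* Fˣ).range := by
    obtain ⟨r, hr⟩ := hx
    have hr0 : r ≠ 0 := by
      rintro rfl
      exact x.ne_zero (hr.trans (mul_zero 0))
    exact ⟨Units.mk0 r hr0, Units.ext ((sq r).trans hr.symm)⟩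
  have hdvd : (powMonoidHom 2 : Fˣ →* Fˣ).range.index ∣ 2 :=
    Subgroup.index_dvd_two_iff.2 ⟨-1, fun b ↦ (h b).symm.imp
      (fun hb ↦ mem_range_of_isSquare _ (by simpa using hb)) (mem_range_of_isSquare b)⟩
  exact ⟨ne_zero_of_dvd_ne_zero two_ne_zero hdvd⟩

theorem isSquare_or_isSquare_neg {K : Type*} [Field K] (v : InfinitePlace K) (x : v.Completion) :
    IsSquare x ∨ IsSquare (-x) := by
  rcases v.isReal_or_isComplex with hv | hv
  · let e := InfinitePlace.Completion.ringEquivRealOfIsReal hv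
    have h : IsSquare (e x) ∨ IsSquare (e (-x)) := by
      simpa only [map_neg, Real.isSquare_iff, neg_nonneg] using le_total 0 (e x)
    exact h.imp (fun h ↦ by simpa using h.map e.symm) fun h ↦ by simpa using h.map e.symm
  · let e := InfinitePlace.Completion.ringEquivComplexOfIsComplex hv
    have h : IsSquare (e x) := IsAlgClosed.exists_eq_mul_self (e x)
    exact .inl (by simpa using h.map e.symm)

variable {K L : Type*} [Field K] [Field L] [Algebra K L]

open scoped NumberField.LiesOver in
theorem finrank_completion_dvd_two (v : InfinitePlace K) (w : InfinitePlace L) [w.LiesOver v] :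
    finrank v.Completion w.Completion ∣ 2 := by
  have hw : w.mult ∣ 2 := by
    rw [InfinitePlace.mult]
    split <;> simp
  exact (Dvd.intro_left _ (InfinitePlace.mult_mul_finrank v w)).trans hw

open scoped NumberField.LiesOver in
theorem finiteIndex_range_unitsMap_infiniteLocalNorm (v : InfinitePlace K) (w : InfinitePlace L)
    [w.LiesOver v] : (Units.map (infiniteLocalNorm v w)).range.FiniteIndex := by
  have := finiteIndex_range_powMonoidHom_two (isSquare_or_isSquare_neg v)
  obtain ⟨k, hk⟩ := finrank_completion_dvd_two v w
  refine Subgroup.finiteIndex_of_le (H := (powMonoidHom 2).range) ?_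
  rintro _ ⟨z, rfl⟩
  refine ⟨Units.map (algebraMap v.Completion w.Completion : _ →* _) z ^ k, Units.ext ?_⟩
  have hnorm : infiniteLocalNorm v w (algebraMap _ _ (z : v.Completion)) =
      z ^ finrank v.Completion w.Completion :=
    Algebra.norm_algebraMap _
  rw [map_pow, Units.val_pow_eq_pow_val, powMonoidHom_apply, Units.val_pow_eq_pow_val, hk, pow_mul,
    ← hnorm]
  rfl

end InfinitePlaces

/-! ### Ideles and ideals -/

section Ideles

open FractionalIdeal nonZeroDivisors

theorem count_spanSingleton {R K : Type*} [CommRing R] [IsDedekindDomain R] [Field K] [Algebra R K]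
    [IsFractionRing R K] (v : HeightOneSpectrum R) {k : K} (hk : k ≠ 0) :
    count K v (spanSingleton R⁰ k) = -WithZero.log (v.valuation K k) := by
  classical
  obtain ⟨a, b, hb, rfl⟩ := IsFractionRing.div_surjective (A := R) k
  have hb0 : b ≠ 0 := nonZeroDivisors.ne_zero hb
  have ha0 : a ≠ 0 := fun h ↦ hk (by rw [h, map_zero, zero_div])
  have hspan : spanSingleton R⁰ (algebraMap R K a / algebraMap R K b) =
      spanSingleton R⁰ (algebraMap R K b)⁻¹ * (Ideal.span {a} : Ideal R) := by
    rw [coeIdeal_span_singleton, spanSingleton_mul_spanSingleton, div_eq_inv_mul]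
  rw [count_well_defined K v (spanSingleton_ne_zero_iff.2 hk) hspan, map_div₀,
    WithZero.log_div (by simpa using ha0) (by simpa using hb0), valuation_of_algebraMap,
    valuation_of_algebraMap, intValuation_if_neg v ha0, intValuation_if_neg v hb0,
    WithZero.log_exp, WithZero.log_exp]
  ring

variable {K : Type*} [Field K] [NumberField K]

/-- The component `x ↦ x_v` of ideles at a finite place. -/
def finiteComponent (v : HeightOneSpectrum (𝓞 K)) : Ideles K →* (v.adicCompletion K)ˣ :=
  Units.map
    { toFun x := x.2 v
      map_one' := rfl
      map_mul' _ _ := rfl }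

/-- The component `x ↦ x_v` of ideles at an infinite place. -/
def infiniteComponent (v : InfinitePlace K) : Ideles K →* v.Completionˣ :=
  Units.map
    { toFun x := x.1 v
      map_one' := rfl
      map_mul' _ _ := rfl }

theorem idele_ext {x y : Ideles K} (hfin : ∀ v, finiteComponent v x = finiteComponent v y)
    (hinf : ∀ v, infiniteComponent v x = infiniteComponent v y) : x = y :=
  Units.ext <| Prod.ext (funext fun v ↦ congrArg Units.val (hinf v))
    (FiniteAdeleRing.ext K fun v ↦ congrArg Units.val (hfin v))

/-- The inclusion `O_vˣ → K_vˣ`. -/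
def localUnits (v : HeightOneSpectrum (𝓞 K)) :
    (v.adicCompletionIntegers K)ˣ →* (v.adicCompletion K)ˣ :=
  Units.map (v.adicCompletionIntegers K).subtype.toMonoidHom

theorem localUnits_injective (v : HeightOneSpectrum (𝓞 K)) : Function.Injective (localUnits v) :=
  Units.map_injective Subtype.val_injective

theorem mem_range_localUnits_iff {v : HeightOneSpectrum (𝓞 K)} {x : (v.adicCompletion K)ˣ} :
    x ∈ (localUnits v).range ↔ Valued.v (x : v.adicCompletion K) = 1 := by
  constructor
  · rintro ⟨u, rfl⟩
    exact adicCompletionIntegers.isUnit_iff_valued_eq_one.1 u.isUnit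
  · intro hx
    have h : IsUnit (⟨x, (mem_adicCompletionIntegers _ _ _).2 hx.le⟩ :
      v.adicCompletionIntegers K) := adicCompletionIntegers.isUnit_iff_valued_eq_one.2 hx
    exact ⟨h.unit, Units.ext rfl⟩

theorem exists_idele_of_localUnits
    (u : ∀ v : HeightOneSpectrum (𝓞 K), (v.adicCompletionIntegers K)ˣ)
    (z : ∀ v : InfinitePlace K, v.Completionˣ) :
    ∃ x : Ideles K, (∀ v, finiteComponent v x = localUnits v (u v)) ∧
      ∀ v, infiniteComponent v x = z v := by
  let integralAdele (u : ∀ v : HeightOneSpectrum (𝓞 K), v.adicCompletionIntegers K) :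
      FiniteAdeleRing (𝓞 K) K := ⟨fun v ↦ u v, .of_forall fun v ↦ (u v).2⟩
  refine ⟨⟨(fun v ↦ z v, integralAdele fun v ↦ u v),
    (fun v ↦ (z v)⁻¹.val, integralAdele fun v ↦ (u v)⁻¹.val), ?_, ?_⟩,
    fun v ↦ Units.ext rfl, fun v ↦ Units.ext rfl⟩
  · exact Prod.ext (funext fun v ↦ (z v).mul_inv)
      (FiniteAdeleRing.ext K fun v ↦ congrArg Subtype.val (u v).mul_inv)
  · exact Prod.ext (funext fun v ↦ (z v).inv_mul)
      (FiniteAdeleRing.ext K fun v ↦ congrArg Subtype.val (u v).inv_mul)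

variable (K) in
/-- The group of ideles which are units at all finite places, with no condition at the infinite
places. -/
def unitIdeles : Subgroup (Ideles K) :=
  ⨅ v : HeightOneSpectrum (𝓞 K), (localUnits v).range.comap (finiteComponent v)

theorem mem_unitIdeles_iff {x : Ideles K} : x ∈ unitIdeles K ↔
    ∀ v, Valued.v (finiteComponent v x : v.adicCompletion K) = 1 := by
  simp only [unitIdeles, Subgroup.mem_iInf, Subgroup.mem_comap, mem_range_localUnits_iff]

theorem eventually_valued_finiteComponent_eq_one (x : Ideles K) :
    ∀ᶠ v : HeightOneSpectrum (𝓞 K) in Filter.cofinite,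
      Valued.v (finiteComponent v x : v.adicCompletion K) = 1 :=
  (FiniteAdeleRing.isUnit_iff.1
    (x.isUnit.map (MonoidHom.snd (InfiniteAdeleRing K) (FiniteAdeleRing (𝓞 K) K)))).2

/-- The fractional ideal `∏ 𝔭_v ^ ord_v(x_v)` of an idele `x`; the valuation `Valued.v` is
multiplicative with value `exp (-1)` at a uniformizer, whence the sign. -/
def ideleIdeal (x : Ideles K) : (FractionalIdeal (𝓞 K)⁰ K)ˣ :=
  Units.mk0 (∏ᶠ v : HeightOneSpectrum (𝓞 K), (v.asIdeal : FractionalIdeal (𝓞 K)⁰ K) ^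
    (-WithZero.log (Valued.v (finiteComponent v x : v.adicCompletion K)))) <|
    finprod_induction (· ≠ 0) one_ne_zero (fun _ _ ↦ mul_ne_zero) fun v ↦
      zpow_ne_zero _ (coeIdeal_ne_zero.2 v.ne_bot)

theorem count_ideleIdeal (x : Ideles K) (v : HeightOneSpectrum (𝓞 K)) :
    count K v (ideleIdeal x : FractionalIdeal (𝓞 K)⁰ K) =
      -WithZero.log (Valued.v (finiteComponent v x : v.adicCompletion K)) := by
  refine count_finprod K v _ ?_
  filter_upwards [eventually_valued_finiteComponent_eq_one x] with v hv
  rw [hv, WithZero.log_one, neg_zero]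

theorem mem_principalIdeles_sup_unitIdeles {x : Ideles K} {k : Kˣ}
    (h : ∀ v, Valued.v (finiteComponent v x : v.adicCompletion K) = v.valuation K k) :
    x ∈ principalIdeles K ⊔ unitIdeles K := by
  let κ : Ideles K := Units.map (algebraMap K (AdeleRing (𝓞 K) K)).toMonoidHom k
  have hκ (v) : (finiteComponent v κ : v.adicCompletion K) = algebraMap K _ k := rfl
  rw [← mul_inv_cancel_left κ x]
  refine Subgroup.mul_mem_sup ⟨k, rfl⟩ (mem_unitIdeles_iff.2 fun v ↦ ?_)
  rw [map_mul, map_inv, Units.val_mul, Units.val_inv_eq_inv_val, map_mul, map_inv₀, h, hκ,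
    valued_algebraMap, inv_mul_cancel₀ ((Valuation.ne_zero_iff _).2 k.ne_zero)]

theorem inv_mul_mem_of_classGroup_mk_ideleIdeal_eq {x y : Ideles K}
    (h : ClassGroup.mk K (ideleIdeal x) = ClassGroup.mk K (ideleIdeal y)) :
    x⁻¹ * y ∈ principalIdeles K ⊔ unitIdeles K := by
  rw [← inv_mul_eq_one, ← map_inv, ← map_mul, ClassGroup.mk_eq_one_iff,
    FractionalIdeal.isPrincipal_iff] at h
  obtain ⟨k, hk⟩ := h
  rw [Units.val_mul, Units.val_inv_eq_inv_val] at hk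
  have hx := (ideleIdeal x).ne_zero
  have hy := (ideleIdeal y).ne_zero
  have hk0 : k ≠ 0 := by
    rintro rfl
    exact mul_ne_zero (inv_ne_zero hx) hy (hk.trans spanSingleton_zero)
  refine mem_principalIdeles_sup_unitIdeles (k := Units.mk0 k hk0) fun v ↦ ?_
  have hcount := congrArg (count K v) hk
  rw [count_mul K v (inv_ne_zero hx) hy, count_inv, count_ideleIdeal, count_ideleIdeal,
    count_spanSingleton v hk0, neg_neg, ← sub_eq_add_neg] at hcount
  have hvx : Valued.v (finiteComponent v x : v.adicCompletion K) ≠ 0 :=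
    (Valuation.ne_zero_iff _).2 (Units.ne_zero _)
  have hvy : Valued.v (finiteComponent v y : v.adicCompletion K) ≠ 0 :=
    (Valuation.ne_zero_iff _).2 (Units.ne_zero _)
  rw [map_mul, map_inv, Units.val_mul, Units.val_inv_eq_inv_val, map_mul, map_inv₀,
    Units.val_mk0, inv_mul_eq_div, ← WithZero.exp_log (div_ne_zero hvy hvx),
    ← WithZero.exp_log ((Valuation.ne_zero_iff (v.valuation K)).2 hk0), WithZero.log_div hvy hvx,
    ← neg_sub, hcount, neg_neg]

variable (K) in
theorem finiteIndex_principalIdeles_sup_unitIdeles :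
    (principalIdeles K ⊔ unitIdeles K).FiniteIndex := by
  have : Finite (Ideles K ⧸ (principalIdeles K ⊔ unitIdeles K)) := by
    refine Finite.of_injective (fun q ↦ ClassGroup.mk K (ideleIdeal q.out)) fun q r h ↦ ?_
    rw [← q.out_eq', ← r.out_eq']
    exact QuotientGroup.eq.2 (inv_mul_mem_of_classGroup_mk_ideleIdeal_eq h)
  exact Subgroup.finiteIndex_of_finite_quotient

end Ideles

/-! ### The norm index -/

section IdeleNorm

theorem rightUnique_liesOver {A B : Type*} [CommRing A] [CommRing B] [Algebra A B] :
    Relator.RightUnique fun (w : HeightOneSpectrum B) (v : HeightOneSpectrum A) ↦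
      w.asIdeal.LiesOver v.asIdeal :=
  fun _ _ _ h h' ↦ HeightOneSpectrum.ext (h.over.trans h'.over.symm)

theorem exists_liesOver {A : Type*} (B : Type*) [CommRing A] [CommRing B] [Algebra A B]
    [Algebra.IsIntegral A B] [FaithfulSMul A B] (v : HeightOneSpectrum A) :
    ∃ w : HeightOneSpectrum B, w.asIdeal.LiesOver v.asIdeal := by
  have := v.isPrime
  obtain ⟨P, hP, hPv⟩ := (inferInstance : Nonempty (v.asIdeal.primesOver B))
  exact ⟨⟨P, hP, Ideal.ne_bot_of_liesOver_of_ne_bot v.ne_bot P⟩, hPv⟩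

theorem rightUnique_infinitePlace_liesOver {K L : Type*} [Field K] [Field L] [Algebra K L] :
    Relator.RightUnique fun (w : InfinitePlace L) (v : InfinitePlace K) ↦ w.LiesOver v :=
  fun w v v' _ _ ↦ (InfinitePlace.LiesOver.comap_eq w v).symm.trans
    (InfinitePlace.LiesOver.comap_eq w v')

variable {K L : Type*} [Field K] [NumberField K] [Field L] [NumberField L] [Algebra K L]

theorem finiteComponent_ideleNorm (v : HeightOneSpectrum (𝓞 K)) (x : Ideles L) :
    finiteComponent v (ideleNorm K L x) =
      ∏ w : {w : HeightOneSpectrum (𝓞 L) // w.asIdeal.LiesOver v.asIdeal},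
        haveI := w.2
        Units.map (finiteLocalNorm v w.1) (finiteComponent w.1 x) :=
  Units.ext (by rw [Units.coe_prod]; rfl)

open scoped Classical in
theorem infiniteComponent_ideleNorm (v : InfinitePlace K) (x : Ideles L) :
    infiniteComponent v (ideleNorm K L x) =
      ∏ w : {w : InfinitePlace L // w.LiesOver v},
        haveI := w.2
        Units.map (infiniteLocalNorm v w.1) (infiniteComponent w.1 x) :=
  Units.ext (by rw [Units.coe_prod]; rfl)

theorem localUnits_unitsMap_finiteIntegersNorm (v : HeightOneSpectrum (𝓞 K))
    (w : HeightOneSpectrum (𝓞 L)) [w.asIdeal.LiesOver v.asIdeal]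
    (y : (w.adicCompletionIntegers L)ˣ) :
    localUnits v (Units.map (finiteIntegersNorm v w) y) =
      Units.map (finiteLocalNorm v w) (localUnits w y) :=
  Units.ext (coe_finiteIntegersNorm v w y)

variable (L)

/-- The subgroup `∏_{w ∣ v} N(O_wˣ)` of `O_vˣ`. -/
def unitNorms (v : HeightOneSpectrum (𝓞 K)) : Subgroup (v.adicCompletionIntegers K)ˣ :=
  ⨆ w : {w : HeightOneSpectrum (𝓞 L) // w.asIdeal.LiesOver v.asIdeal},
    haveI := w.2
    (Units.map (finiteIntegersNorm v w.1)).range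

/-- The subgroup `∏_{w ∣ v} N(L_wˣ)` of `K_vˣ` for an infinite place `v`. -/
def infiniteNorms (v : InfinitePlace K) : Subgroup v.Completionˣ :=
  ⨆ w : {w : InfinitePlace L // w.LiesOver v},
    haveI := w.2
    (Units.map (infiniteLocalNorm v w.1)).range

theorem finiteIndex_unitNorms (v : HeightOneSpectrum (𝓞 K)) : (unitNorms L v).FiniteIndex := by
  obtain ⟨w, hw⟩ := exists_liesOver (𝓞 L) v
  have := finiteIndex_range_unitsMap_finiteIntegersNorm v w
  exact Subgroup.finiteIndex_of_le (le_iSup_of_le ⟨w, hw⟩ le_rfl)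

variable (K) in
theorem eventually_unitNorms_eq_top :
    ∀ᶠ v : HeightOneSpectrum (𝓞 K) in Filter.cofinite, unitNorms L v = ⊤ := by
  filter_upwards [eventually_unitsMap_finiteIntegersNorm_surjective K L] with v hv
  obtain ⟨w, hw⟩ := exists_liesOver (𝓞 L) v
  rw [eq_top_iff, ← MonoidHom.range_eq_top.2 (hv w hw)]
  exact le_iSup_of_le ⟨w, hw⟩ le_rfl

theorem finiteIndex_infiniteNorms (v : InfinitePlace K) : (infiniteNorms L v).FiniteIndex := by
  obtain ⟨w, rfl⟩ := InfinitePlace.comap_surjective (K := L) v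
  have hw : w.LiesOver (w.comap (algebraMap K L)) := ⟨rfl⟩
  have := finiteIndex_range_unitsMap_infiniteLocalNorm (w.comap (algebraMap K L)) w
  exact Subgroup.finiteIndex_of_le (le_iSup_of_le ⟨w, hw⟩ le_rfl)

variable (K)

/-- The ideles of `K` whose components are norms of units of the `O_w` at the finite places, and
norms at the infinite places. They are the norms of the unit ideles of `L`. -/
def unitNormIdeles : Subgroup (Ideles K) :=
  (⨅ v : HeightOneSpectrum (𝓞 K), ((unitNorms L v).map (localUnits v)).comap (finiteComponent v)) ⊓
    ⨅ v : InfinitePlace K, (infiniteNorms L v).comap (infiniteComponent v)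

theorem unitNormIdeles_le_range_ideleNorm : unitNormIdeles K L ≤ (ideleNorm K L).range := by
  classical
  intro x hx
  obtain ⟨hfin, hinf⟩ := Subgroup.mem_inf.1 hx
  simp only [Subgroup.mem_iInf, Subgroup.mem_comap, Subgroup.mem_map] at hfin hinf
  choose u hu hux using hfin
  obtain ⟨y, hy⟩ := exists_forall_prod_fiber_eq rightUnique_liesOver
    (fun w ↦ ⟨w.under (𝓞 K), ⟨rfl⟩⟩)
    (N := fun w v (_ : w.asIdeal.LiesOver v.asIdeal) ↦ Units.map (finiteIntegersNorm v w)) hu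
  obtain ⟨z, hz⟩ := exists_forall_prod_fiber_eq rightUnique_infinitePlace_liesOver
    (fun w ↦ ⟨w.comap (algebraMap K L), ⟨rfl⟩⟩)
    (N := fun w v (_ : w.LiesOver v) ↦ Units.map (infiniteLocalNorm v w)) hinf
  obtain ⟨Y, hYy, hYz⟩ := exists_idele_of_localUnits y z
  refine ⟨Y, idele_ext (fun v ↦ ?_) fun v ↦ ?_⟩
  · simp only [finiteComponent_ideleNorm, hYy, ← hux v, ← hy v, map_prod,
      localUnits_unitsMap_finiteIntegersNorm]
  · simp only [infiniteComponent_ideleNorm, hYz, ← hz v]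

theorem relIndex_unitNormIdeles_ne_zero : (unitNormIdeles K L).relIndex (unitIdeles K) ≠ 0 := by
  refine Subgroup.relIndex_inf_ne_zero (relIndex_iInf_iInf_ne_zero ?_ fun v ↦ ?_)
    (Subgroup.relIndex_iInf_ne_zero fun v ↦ ?_)
  · filter_upwards [eventually_unitNorms_eq_top K L] with v hv
    rw [hv, MonoidHom.range_eq_map]
  · refine Subgroup.relIndex_comap_ne_zero _ ?_
    rw [MonoidHom.range_eq_map, Subgroup.relIndex_map_map_of_injective _ _ (localUnits_injective v),
      Subgroup.relIndex_top_right]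
    exact (finiteIndex_unitNorms L v).index_ne_zero
  · refine mt (Subgroup.relIndex_eq_zero_of_le_right le_top)
      (Subgroup.relIndex_comap_ne_zero (K := ⊤) _ ?_)
    rw [Subgroup.relIndex_top_right]
    exact (finiteIndex_infiniteNorms L v).index_ne_zero

end IdeleNorm

end NormIndex

end

theorem mainTheorem2_general (K L : Type*) [Field K] [NumberField K] [Field L] [NumberField L]
    [Algebra K L] : (NormIndex.normSubgroup K L).FiniteIndex := by
  apply NormIndex.finiteIndex_sup_of_relIndex_ne_zero
    (NormIndex.finiteIndex_principalIdeles_sup_unitIdeles K)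
  exact mt (Subgroup.relIndex_eq_zero_of_le_left (NormIndex.unitNormIdeles_le_range_ideleNorm K L))
    (NormIndex.relIndex_unitNormIdeles_ne_zero K L)

theorem mainTheorem2 (K L : Type*) [Field K] [NumberField K] [Field L] [NumberField L]
    [Algebra K L] [IsGalois K L] [IsCyclic (L ≃ₐ[K] L)] :
    (NormIndex.normSubgroup K L).FiniteIndex :=
  mainTheorem2_general K L
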